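/- Let $(X_s)_{s\ge 0}$ be an irreducible continuous-time Markov chain on a finite state space $\Sigma$, with right-continuous paths, generator $L$, transition matrices $P_s=e^{sL}$ and an arbitrary initial distribution $\nu$. Let $\pi$ be its invariant distribution, put $\pi_\star=\min_{x\in\Sigma}\pi(x)$ and $\pi(g)=\sum_{x\in\Sigma}\pi(x)g(x)$ for $g:\Sigma\to\mathbb R$, and let $$T=\min\Big\{s\ge 0:\ \max_{x\in\Sigma}\tfrac12\sum_{y\in\Sigma}|P_s(x,y)-\pi(y)|\le \tfrac14\Big\}$$ be its mixing time. Then for every $t>0$, every function $f:\Sigma\to[-1,1]$ and every real $\sigma$ with $\pi(f)=0$ and $\pi(f^2)\le\sigma^2$, and every $\gamma$ with $0<\gamma\le \min(\sigma^2,\tfrac12)$, $$\mathbb P\Big[\int_0^t f(X_s)\,\mathrm ds\ge\gamma t\Big]\le 4\exp\Big\{-\Big\lfloor\frac{t}{k(\gamma)T}-1\Big\rfloor\frac{\gamma^2}{6\sigma^2}\Big\},\qquad k(\gamma)=-\log_2\Big(\frac{\pi_\star\gamma^2}{6\sigma^2}\Big).$$ (If $\Sigma$ has only one point, then $T=0$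 and $f=0$, so the probability is $0$; in this case the fraction $t/(k(\gamma)T)$ is read as $0$.) -/

import Mathlib

open MeasureTheory Filter Topology
open scoped NNReal Matrix

noncomputable section

namespace CTMC

variable {S : Type*} [Fintype S] [DecidableEq S]

/-- `L` is the generator (Q-matrix) of a Markov chain on `S`: the off-diagonal entries are
nonnegative jump rates, and each row sums to zero. -/
structure IsGenerator (L : Matrix S S ℝ) : Prop where
  nonneg : ∀ x y, x ≠ y → 0 ≤ L x y
  row_sum : ∀ x, ∑ y, L x y = 0

/-- The transition matrix `P_t = exp (t L)`. -/
def transition (L : Matrix S S ℝ) (t : ℝ) : Matrix S S ℝ :=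
  NormedSpace.exp (t • L)

/-- Irreducibility: every state can be reached from every state with positive probability. -/
def IsIrreducible (L : Matrix S S ℝ) : Prop :=
  ∀ x y, ∃ t : ℝ, 0 ≤ t ∧ 0 < transition L t x y

/-- `π` is an invariant probability distribution: `π P_t = π` for all `t ≥ 0`. -/
def IsInvariant (L : Matrix S S ℝ) (π : S → ℝ) : Prop :=
  π ∈ stdSimplex ℝ S ∧ ∀ t : ℝ, 0 ≤ t → π ᵥ* transition L t = π

/-- Total variation distance of two distributions on a finite set. -/
def tvDist (p q : S → ℝ) : ℝ :=
  (1 / 2) * ∑ x, |p x - q x|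

/-- The mixing time: the least `t ≥ 0` with `max_x ‖P_t(x, ·) - π‖_TV ≤ 1/4`. -/
def mixingTime (L : Matrix S S ℝ) (π : S → ℝ) : ℝ :=
  sInf {t : ℝ | 0 ≤ t ∧ ∀ x, tvDist (transition L t x) π ≤ 1 / 4}

/-- `X` is a continuous-time Markov chain with generator `L` and initial distribution `ν` under
the probability measure `μ`: its finite-dimensional distributions are those given by `ν` and the
transition semigroup, and almost all of its paths are right-continuous for the discrete topology
on `S`. -/
structure IsMarkovChain {Ω : Type*} [MeasurableSpace Ω] [MeasurableSpace S] (μ : Measure Ω)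
    (L : Matrix S S ℝ) (ν : S → ℝ) (X : ℝ≥0 → Ω → S) : Prop where
  measurable : ∀ t, Measurable (X t)
  fdd : ∀ (n : ℕ) (t : Fin (n + 1) → ℝ≥0), Monotone t → t 0 = 0 → ∀ x : Fin (n + 1) → S,
    μ.real {ω | ∀ i, X (t i) ω = x i} =
      ν (x 0) * ∏ i : Fin n,
        transition L ((t i.succ : ℝ) - (t i.castSucc : ℝ)) (x i.castSucc) (x i.succ)
  rightContinuous : ∀ᵐ ω ∂μ, ∀ t, ∀ᶠ s in 𝓝[≥] t, X s ω = X t ω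

/-- The mean `π(f)`. -/
def mean (π f : S → ℝ) : ℝ :=
  ∑ x, π x * f x

/-- `π_⋆ = min_x π(x)`. -/
def minMass (π : S → ℝ) : ℝ :=
  ⨅ x, π x

/-- `k(γ) = - log₂ (π_⋆ γ² / (6 σ²))`. -/
def kFactor (π : S → ℝ) (σ γ : ℝ) : ℝ :=
  -Real.logb 2 (minMass π * γ ^ 2 / (6 * σ ^ 2))

end CTMC

end

/-! Cut `[0, t]` into `m + 1` blocks of length `r = t / (m + 1) ≥ k(γ) T`, where `m` is the floor in
the exponent. The time average of `f` is the average over offsets `s ∈ (0, r]` of the skeleton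
averages of `f(X_{s + jr})`, so by Jensen (`exp_integral_le_integral_exp_sum`) it suffices to bound
exponential moments of each skeleton.

A skeleton step of length `r` has transition probabilities at most `(1 + γ²/(6σ²)) π`
(`transition_le_of_kFactor_mul_mixingTime_le`), so the samples after the first behave almost like
independent draws from `π`. Each costs a Bernstein-type factor (`mean_exp_le`) times a small mixing
error; the first sample costs `exp l`. Chernoff with `l = γ/(2σ²)` concludes
(`measureReal_integral_ge_le`). -/

namespace CTMC

/-! ### Total variation distance and its contraction. -/

variable {S : Type*} [Fintype S]

lemma two_mul_tvDist (p q : S → ℝ) : 2 * tvDist p q = ∑ x, |p x - q x| := by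
  rw [tvDist]
  ring

/-- If all rows of `P` are within `ℓ¹` distance `ρ` of a common vector `w`, then `P` contracts the
total variation distance of vectors of equal mass by the factor `ρ`. -/
lemma tvDist_vecMul_le {P : Matrix S S ℝ} {w : S → ℝ} {ρ : ℝ}
    (hP : ∀ x, ∑ y, |P x y - w y| ≤ ρ) {p q : S → ℝ} (hpq : ∑ x, p x = ∑ x, q x) :
    tvDist (p ᵥ* P) (q ᵥ* P) ≤ ρ * tvDist p q := by
  have hsum : ∑ x, (p x - q x) = 0 := by rw [Finset.sum_sub_distrib, hpq, sub_self]
  -- As `p - q` has mass zero, `w` can be subtracted from every row for free.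
  have key : ∀ y, (p ᵥ* P) y - (q ᵥ* P) y = ∑ x, (p x - q x) * (P x y - w y) := by
    intro y
    simp only [mul_sub, Finset.sum_sub_distrib, ← Finset.sum_mul, hsum, zero_mul, sub_zero]
    simp only [sub_mul, Finset.sum_sub_distrib, Matrix.vecMul, dotProduct]
  have : ∑ y, |(p ᵥ* P) y - (q ᵥ* P) y| ≤ ρ * ∑ x, |p x - q x| := by
    calc ∑ y, |(p ᵥ* P) y - (q ᵥ* P) y|
        ≤ ∑ y, ∑ x, |p x - q x| * |P x y - w y| := by
          refine Finset.sum_le_sum fun y _ => ?_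
          rw [key]
          exact (Finset.abs_sum_le_sum_abs _ _).trans_eq
            (Finset.sum_congr rfl fun x _ => abs_mul _ _)
      _ = ∑ x, |p x - q x| * ∑ y, |P x y - w y| := by
          rw [Finset.sum_comm]
          simp only [Finset.mul_sum]
      _ ≤ ∑ x, |p x - q x| * ρ :=
          Finset.sum_le_sum fun x _ => mul_le_mul_of_nonneg_left (hP x) (abs_nonneg _)
      _ = ρ * ∑ x, |p x - q x| := by rw [← Finset.sum_mul, mul_comm]
  rw [tvDist, tvDist]
  linarith

/-- An excess at `y` is compensated by an equal deficit elsewhere, which cancels the factor `1/2`.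
-/
lemma sub_le_tvDist {p q : S → ℝ} (hpq : ∑ x, p x = ∑ x, q x) (y : S) :
    p y - q y ≤ tvDist p q := by
  classical
  have hsum : ∑ x, (p x - q x) = 0 := by rw [Finset.sum_sub_distrib, hpq, sub_self]
  have h1 := Finset.add_sum_erase Finset.univ (fun x => p x - q x) (Finset.mem_univ y)
  have h2 := Finset.add_sum_erase Finset.univ (fun x => |p x - q x|) (Finset.mem_univ y)
  have h3 := Finset.abs_sum_le_sum_abs (fun x => p x - q x) (Finset.univ.erase y)
  have h4 := neg_abs_le (∑ x ∈ Finset.univ.erase y, (p x - q x))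
  have h5 := le_abs_self (p y - q y)
  rw [tvDist]
  linarith

lemma minMass_le (π : S → ℝ) (x : S) : minMass π ≤ π x :=
  ciInf_le (Set.finite_range π).bddBelow x

variable [DecidableEq S] {L : Matrix S S ℝ} {π : S → ℝ}

/-! ### Positivity and row sums of the transition semigroup. -/

section Semigroup

open scoped Matrix.Norms.Operator

lemma transition_add (L : Matrix S S ℝ) (s t : ℝ) :
    transition L (s + t) = transition L s * transition L t := by
  rw [transition, add_smul, Matrix.exp_add_of_commute]
  · rfl
  · exact ((Commute.refl L).smul_left s).smul_right t

lemma continuous_transition (L : Matrix S S ℝ) : Continuous (transition L) :=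
  (NormedSpace.exp_continuous (𝔸 := Matrix S S ℝ)).comp (continuous_id.smul continuous_const)

/-- The exponential of an entrywise nonnegative matrix dominates the identity entrywise. -/
lemma one_le_exp_of_nonneg {A : Matrix S S ℝ} (hA : ∀ x y, 0 ≤ A x y) (x y : S) :
    (1 : Matrix S S ℝ) x y ≤ NormedSpace.exp A x y := by
  have hpow : ∀ n : ℕ, ∀ x y, 0 ≤ (A ^ n) x y := by
    intro n
    induction n with
    | zero =>
      intro x y
      rw [pow_zero, Matrix.one_apply]
      split_ifs <;> norm_num
    | succ n ih =>
      intro x y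
      rw [pow_succ, Matrix.mul_apply]
      exact Finset.sum_nonneg fun z _ => mul_nonneg (ih x z) (hA z y)
  have h := NormedSpace.exp_series_hasSum_exp' (𝕂 := ℝ) A
  have h' : HasSum (fun n : ℕ => ((n.factorial : ℝ)⁻¹ • A ^ n) x y) (NormedSpace.exp A x y) :=
    (Pi.hasSum.1 (Pi.hasSum.1 h x)) y
  have := le_hasSum h' 0 fun n _ => by
    rw [Matrix.smul_apply, smul_eq_mul]
    exact mul_nonneg (by positivity) (hpow n x y)
  simpa using this

/-- Up to a positive scalar, `P_t` is the exponential of a nonnegative matrix. -/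
lemma IsGenerator.exists_transition_ge (hL : IsGenerator L) {t : ℝ} (ht : 0 ≤ t) :
    ∃ c : ℝ, 0 < c ∧ ∀ x y, c * (1 : Matrix S S ℝ) x y ≤ transition L t x y := by
  -- With `c` above all exit rates, `L + c • 1` is entrywise nonnegative.
  obtain ⟨c, hc⟩ : ∃ c : ℝ, ∀ x, -L x x ≤ c := by
    obtain ⟨c, hc⟩ := (Set.finite_range fun x => -L x x).bddAbove
    exact ⟨c, fun x => hc ⟨x, rfl⟩⟩
  have hexp : transition L t
      = NormedSpace.exp ((-(t * c)) • (1 : Matrix S S ℝ)) * NormedSpace.exp (t • (L + c • 1)) := by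
    rw [← Matrix.exp_add_of_commute]
    · rw [transition]
      congr 1
      module
    · exact (Commute.one_left _).smul_left _
  have hscal : NormedSpace.exp ((-(t * c)) • (1 : Matrix S S ℝ)) = Real.exp (-(t * c)) • 1 := by
    have h := NormedSpace.algebraMap_exp_comm (𝔸 := Matrix S S ℝ) (-(t * c))
    rw [← Real.exp_eq_exp_ℝ, Algebra.algebraMap_eq_smul_one, Algebra.algebraMap_eq_smul_one] at h
    exact h.symm
  refine ⟨Real.exp (-(t * c)), Real.exp_pos _, fun x y => ?_⟩
  rw [hexp, hscal, smul_mul_assoc, one_mul, Matrix.smul_apply, smul_eq_mul]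
  refine mul_le_mul_of_nonneg_left (one_le_exp_of_nonneg (fun x y => ?_) x y) (Real.exp_pos _).le
  rw [Matrix.smul_apply, Matrix.add_apply, Matrix.smul_apply, smul_eq_mul, smul_eq_mul]
  refine mul_nonneg ht ?_
  by_cases h : x = y
  · subst h
    rw [Matrix.one_apply_eq]
    linarith [hc x]
  · rw [Matrix.one_apply_ne h]
    linarith [hL.nonneg x y h]

lemma IsGenerator.transition_nonneg (hL : IsGenerator L) {t : ℝ} (ht : 0 ≤ t) (x y : S) :
    0 ≤ transition L t x y := by
  obtain ⟨c, hc, h⟩ := hL.exists_transition_ge ht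
  refine le_trans ?_ (h x y)
  rw [Matrix.one_apply]
  split_ifs <;> simp [hc.le]

lemma IsGenerator.transition_self_pos (hL : IsGenerator L) {t : ℝ} (ht : 0 ≤ t) (x : S) :
    0 < transition L t x x := by
  obtain ⟨c, hc, h⟩ := hL.exists_transition_ge ht
  exact lt_of_lt_of_le (by simpa using hc) (h x x)

lemma IsGenerator.transition_row_sum (hL : IsGenerator L) (t : ℝ) (x : S) :
    ∑ y, transition L t x y = 1 := by
  have h := NormedSpace.exp_series_hasSum_exp' (𝕂 := ℝ) (t • L)
  have h' : HasSum (fun n : ℕ => ∑ y, ((n.factorial : ℝ)⁻¹ • (t • L) ^ n) x y)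
      (∑ y, transition L t x y) :=
    hasSum_sum fun y _ => (Pi.hasSum.1 (Pi.hasSum.1 h x)) y
  refine h'.unique ?_
  convert hasSum_ite_eq (0 : ℕ) (1 : ℝ) using 2 with n
  cases n with
  | zero => simp [Matrix.one_apply]
  | succ n =>
    simp only [Nat.add_eq_zero_iff, one_ne_zero, and_false, if_false]
    simp only [pow_succ, Matrix.smul_apply, Matrix.mul_apply, smul_eq_mul]
    rw [← Finset.mul_sum, Finset.sum_comm]
    simp only [← Finset.mul_sum, hL.row_sum, mul_zero, Finset.sum_const_zero]

end Semigroup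

/-! ### Decay of the distance to equilibrium. -/

section Contraction

lemma transition_add_apply (L : Matrix S S ℝ) (s u : ℝ) (x : S) :
    transition L (s + u) x = transition L s x ᵥ* transition L u := by
  rw [transition_add]
  rfl

/-- If the rows of `P_u` are within `ℓ¹` distance `ρ` of a common vector, then running the chain
for an additional time `u` multiplies the distance from equilibrium by at most `ρ`. -/
lemma IsInvariant.tvDist_transition_add_le (hπ : IsInvariant L π) (hL : IsGenerator L)
    {u ρ : ℝ} (hu : 0 ≤ u) {w : S → ℝ} (hw : ∀ x, ∑ y, |transition L u x y - w y| ≤ ρ)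
    (s : ℝ) (x : S) :
    tvDist (transition L (s + u) x) π ≤ ρ * tvDist (transition L s x) π := by
  rw [transition_add_apply]
  conv_lhs => rw [← hπ.2 u hu]
  exact tvDist_vecMul_le hw (by rw [hL.transition_row_sum, hπ.1.2])

lemma IsInvariant.tvDist_transition_antitone (hπ : IsInvariant L π) (hL : IsGenerator L)
    {s u : ℝ} (hsu : s ≤ u) (x : S) :
    tvDist (transition L u x) π ≤ tvDist (transition L s x) π := by
  have hw : ∀ x, ∑ y, |transition L (u - s) x y - (0 : S → ℝ) y| ≤ 1 := fun x => by
    simp only [Pi.zero_apply, sub_zero, abs_of_nonneg (hL.transition_nonneg (sub_nonneg.2 hsu) _ _)]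
    exact (hL.transition_row_sum _ x).le
  simpa using hπ.tvDist_transition_add_le hL (sub_nonneg.2 hsu) hw s x

/-- Iterated form of `IsInvariant.tvDist_transition_add_le`. -/
lemma IsInvariant.tvDist_transition_add_mul_le (hπ : IsInvariant L π) (hL : IsGenerator L)
    {u ρ : ℝ} (hu : 0 ≤ u) (hρ : 0 ≤ ρ) {w : S → ℝ}
    (hw : ∀ x, ∑ y, |transition L u x y - w y| ≤ ρ) (s : ℝ) (n : ℕ) (x : S) :
    tvDist (transition L (s + n * u) x) π ≤ ρ ^ n * tvDist (transition L s x) π := by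
  induction n with
  | zero => simp
  | succ n ih =>
    have h := hπ.tvDist_transition_add_le hL hu hw (s + n * u) x
    have e : s + ((n + 1 : ℕ) : ℝ) * u = s + n * u + u := by push_cast; ring
    rw [e, pow_succ', mul_assoc]
    exact h.trans (mul_le_mul_of_nonneg_left ih hρ)

end Contraction

/-! ### Convergence to equilibrium and the mixing time. -/

section Mixing

/-- An irreducible chain has, at some time, strictly positive transition probabilities. -/
lemma IsIrreducible.exists_transition_pos (hirr : IsIrreducible L) (hL : IsGenerator L) :
    ∃ t : ℝ, 0 ≤ t ∧ ∀ x y, 0 < transition L t x y := by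
  choose τ hτ0 hτ using hirr
  obtain ⟨c, hc⟩ := (Set.finite_range fun z : S × S => τ z.1 z.2).bddAbove
  have hc' : ∀ x y, τ x y ≤ max c 0 := fun x y => (hc ⟨(x, y), rfl⟩).trans (le_max_left _ _)
  refine ⟨max c 0, le_max_right _ _, fun x y => ?_⟩
  have h0 : 0 ≤ max c 0 - τ x y := sub_nonneg.2 (hc' x y)
  -- Reach `y` by time `τ x y`, then be at `y` again at the common time.
  rw [← add_sub_cancel (τ x y) (max c 0), transition_add, Matrix.mul_apply]
  exact Finset.sum_pos'
    (fun z _ => mul_nonneg (hL.transition_nonneg (hτ0 x y) x z) (hL.transition_nonneg h0 z y))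
    ⟨y, Finset.mem_univ y, mul_pos (hτ x y) (hL.transition_self_pos h0 y)⟩

lemma IsInvariant.pos (hπ : IsInvariant L π) (hirr : IsIrreducible L) (hL : IsGenerator L)
    (y : S) : 0 < π y := by
  obtain ⟨t, ht, hpos⟩ := hirr.exists_transition_pos hL
  obtain ⟨x, hx⟩ : ∃ x, 0 < π x := by
    by_contra! h
    have h1 : ∑ x, π x ≤ 0 := Finset.sum_nonpos fun x _ => h x
    rw [hπ.1.2] at h1
    linarith
  rw [← hπ.2 t ht]
  exact Finset.sum_pos' (fun z _ => mul_nonneg (hπ.1.1 z) (hpos z y).le)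
    ⟨x, Finset.mem_univ x, mul_pos hx (hpos x y)⟩

lemma IsInvariant.minMass_pos (hπ : IsInvariant L π) (hirr : IsIrreducible L)
    (hL : IsGenerator L) [Nonempty S] : 0 < minMass π := by
  obtain ⟨x, hx⟩ := exists_eq_ciInf_of_finite (f := π)
  rw [minMass, ← hx]
  exact hπ.pos hirr hL x

lemma IsInvariant.nonempty (hπ : IsInvariant L π) : Nonempty S := by
  by_contra h
  rw [not_nonempty_iff] at h
  simpa using hπ.1.2

/-- Convergence to equilibrium, by Doeblin's minorization. -/
lemma IsInvariant.exists_tvDist_le (hπ : IsInvariant L π) (hirr : IsIrreducible L)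
    (hL : IsGenerator L) {ε : ℝ} (hε : 0 < ε) :
    ∃ t : ℝ, 0 ≤ t ∧ ∀ x, tvDist (transition L t x) π ≤ ε := by
  have := hπ.nonempty
  obtain ⟨u, hu, hpos⟩ := hirr.exists_transition_pos hL
  obtain ⟨z, hz⟩ := exists_eq_ciInf_of_finite (f := fun z : S × S => transition L u z.1 z.2)
  set δ : ℝ := transition L u z.1 z.2 with hδ
  have hδ0 : 0 < δ := hpos _ _
  have hle : ∀ x y, δ ≤ transition L u x y := fun x y => by
    have h1 : δ = _ := hz
    rw [h1]
    exact ciInf_le (Set.finite_range fun z : S × S => transition L u z.1 z.2).bddBelow (x, y)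
  -- Subtracting the minorant `δ` leaves nonnegative rows of mass `ρ < 1`.
  set ρ : ℝ := 1 - Fintype.card S * δ with hρ
  have hw : ∀ x, ∑ y, |transition L u x y - (fun _ => δ) y| = ρ := fun x => by
    simp only [abs_of_nonneg (sub_nonneg.2 (hle x _)), Finset.sum_sub_distrib,
      hL.transition_row_sum, Finset.sum_const, Finset.card_univ, nsmul_eq_mul, hρ]
  have hρ0 : 0 ≤ ρ := by
    rw [← hw (Classical.arbitrary S)]
    exact Finset.sum_nonneg fun _ _ => abs_nonneg _
  have hρ1 : ρ < 1 := by
    have : (0 : ℝ) < Fintype.card S := by exact_mod_cast Fintype.card_pos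
    have := mul_pos this hδ0
    linarith
  obtain ⟨C, hC⟩ := (Set.finite_range fun x => tvDist (transition L 0 x) π).bddAbove
  have hlim : Tendsto (fun n : ℕ => ρ ^ n * C) atTop (𝓝 0) := by
    simpa using (tendsto_pow_atTop_nhds_zero_of_lt_one hρ0 hρ1).mul_const C
  obtain ⟨n, hn⟩ := (hlim.eventually (gt_mem_nhds hε)).exists
  refine ⟨0 + n * u, by positivity, fun x => ?_⟩
  calc _ ≤ ρ ^ n * tvDist (transition L 0 x) π :=
        hπ.tvDist_transition_add_mul_le hL hu hρ0 (fun x => (hw x).le) 0 n x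
    _ ≤ ρ ^ n * C := mul_le_mul_of_nonneg_left (hC ⟨x, rfl⟩) (by positivity)
    _ ≤ ε := hn.le

/-- The infimum is attained: the set is closed by continuity and nonempty by convergence. -/
lemma mixingTime_mem (hπ : IsInvariant L π) (hirr : IsIrreducible L) (hL : IsGenerator L) :
    0 ≤ mixingTime L π ∧ ∀ x, tvDist (transition L (mixingTime L π) x) π ≤ 1 / 4 := by
  have hcont : ∀ x, Continuous fun t => tvDist (transition L t x) π := fun x => by
    unfold tvDist
    refine continuous_const.mul (continuous_finsetSum _ fun y _ => ?_)
    exact (((continuous_transition L).matrix_elem x y).sub continuous_const).abs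
  have hclosed : IsClosed {t : ℝ | 0 ≤ t ∧ ∀ x, tvDist (transition L t x) π ≤ 1 / 4} := by
    rw [Set.ofPred_and]
    refine isClosed_Ici.inter ?_
    rw [Set.ofPred_forall]
    exact isClosed_iInter fun x => isClosed_le (hcont x) continuous_const
  exact hclosed.csInf_mem (hπ.exists_tvDist_le hirr hL (by norm_num)) ⟨0, fun t ht => ht.1⟩

/-- Each further `T` halves the distance, since the `ℓ¹` distance at `T` is at most `1/2`. The first
`T` already gives `1/4`, and this spare factor `2` absorbs the rounding of `k`. -/
lemma tvDist_transition_le_two_rpow (hπ : IsInvariant L π) (hirr : IsIrreducible L)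
    (hL : IsGenerator L) {k s : ℝ} (hk : 1 ≤ k) (hs : k * mixingTime L π ≤ s) (x : S) :
    tvDist (transition L s x) π ≤ 2 ^ (-k) := by
  obtain ⟨hT0, hT⟩ := mixingTime_mem hπ hirr hL
  set T := mixingTime L π
  obtain ⟨j, hj⟩ : ∃ j, ⌊k⌋₊ = j + 1 :=
    Nat.exists_eq_succ_of_ne_zero (Nat.floor_pos.2 hk).ne'
  have hw : ∀ x, ∑ y, |transition L T x y - π y| ≤ 1 / 2 := fun x => by
    have := hT x
    rw [← two_mul_tvDist]
    linarith
  have hjk : (j : ℝ) + 1 ≤ k := by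
    have := Nat.floor_le (zero_le_one.trans hk)
    rw [hj] at this
    exact_mod_cast this
  have hkj : k < j + 2 := by
    have := Nat.lt_floor_add_one k
    rw [hj] at this
    push_cast at this
    linarith
  calc tvDist (transition L s x) π
      ≤ tvDist (transition L (T + j * T) x) π :=
        hπ.tvDist_transition_antitone hL (by nlinarith) x
    _ ≤ (1 / 2) ^ j * tvDist (transition L T x) π :=
        hπ.tvDist_transition_add_mul_le hL hT0 (by norm_num) hw T j x
    _ ≤ (1 / 2) ^ j * (1 / 4) := mul_le_mul_of_nonneg_left (hT x) (by positivity)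
    _ = (2 : ℝ) ^ (-((j : ℝ) + 2)) := by
        rw [Real.rpow_neg (by norm_num), Real.rpow_add (by norm_num), Real.rpow_natCast]
        rw [one_div, inv_pow]
        norm_num [mul_comm]
    _ ≤ 2 ^ (-k) := Real.rpow_le_rpow_of_exponent_le (by norm_num) (by linarith)

end Mixing

end CTMC

namespace CTMC

/-! ### Exponential moments and products of kernels. -/

section ExponentialMoments

lemma exp_le_one_add_add_mul_sq {u : ℝ} (hu : |u| ≤ 1 / 2) :
    Real.exp u ≤ 1 + u + 11 / 18 * u ^ 2 := by
  -- The cubic remainder is at most `2/9 |u|³ ≤ u²/9`, and `1/2 + 1/9 = 11/18`.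
  have h := (abs_le.1 (Real.exp_bound (hu.trans (by norm_num)) (n := 3) (by norm_num))).2
  norm_num [Finset.sum_range_succ, Nat.factorial] at h
  have h3 : |u| ^ 3 ≤ 1 / 2 * u ^ 2 := by
    rw [pow_succ, sq_abs, mul_comm]
    exact mul_le_mul_of_nonneg_right hu (sq_nonneg u)
  linarith

variable {S : Type*} [Fintype S]

/-- Exponential moment of a centered bounded function, with Bernstein-type variance dependence. -/
lemma mean_exp_le {π f : S → ℝ} (hπ : π ∈ stdSimplex ℝ S) (hf : ∀ x, |f x| ≤ 1)
    (hf0 : mean π f = 0) {l : ℝ} (hl0 : 0 ≤ l) (hl : l ≤ 1 / 2) :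
    mean π (fun x => Real.exp (l * f x)) ≤
      Real.exp (11 / 18 * l ^ 2 * mean π (fun x => f x ^ 2)) := by
  have hle : ∀ x, Real.exp (l * f x) ≤ 1 + l * f x + 11 / 18 * l ^ 2 * f x ^ 2 := fun x => by
    have : |l * f x| ≤ 1 / 2 := by
      rw [abs_mul, abs_of_nonneg hl0]
      nlinarith [hf x, abs_nonneg (f x)]
    exact (exp_le_one_add_add_mul_sq this).trans_eq (by ring)
  calc mean π (fun x => Real.exp (l * f x))
      ≤ ∑ x, π x * (1 + l * f x + 11 / 18 * l ^ 2 * f x ^ 2) :=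
        Finset.sum_le_sum fun x _ => mul_le_mul_of_nonneg_left (hle x) (hπ.1 x)
    _ = ∑ x, π x + l * mean π f + 11 / 18 * l ^ 2 * mean π (fun x => f x ^ 2) := by
        simp only [mean, Finset.mul_sum, ← Finset.sum_add_distrib]
        exact Finset.sum_congr rfl fun x _ => by ring
    _ = 11 / 18 * l ^ 2 * mean π (fun x => f x ^ 2) + 1 := by rw [hπ.2, hf0]; ring
    _ ≤ _ := Real.add_one_le_exp _

/-- The total mass of a product of nonnegative kernels, started from `ν`, is at most the product of
the maximal row sums. -/
lemma sum_mul_prod_kernel_le {ν : S → ℝ} (hν : ν ∈ stdSimplex ℝ S) (n : ℕ)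
    (K : Fin n → S → S → ℝ) (hK : ∀ i x y, 0 ≤ K i x y) (C : Fin n → ℝ)
    (hC : ∀ i x, ∑ y, K i x y ≤ C i) :
    ∑ x : Fin (n + 1) → S, ν (x 0) * ∏ i : Fin n, K i (x i.castSucc) (x i.succ) ≤ ∏ i, C i := by
  induction n with
  | zero =>
    simp only [Finset.univ_eq_empty, Finset.prod_empty, mul_one]
    rw [← hν.2]
    exact (Fintype.sum_equiv (Equiv.funUnique (Fin 1) S) _ _ fun x => rfl).le
  | succ n ih =>
    have ih' := ih (fun i => K i.castSucc) (fun i => hK _) (fun i => C i.castSucc) fun i => hC _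
    have hC0 : ∀ x : S, 0 ≤ C (Fin.last n) := fun x =>
      (Finset.sum_nonneg fun y _ => hK _ x y).trans (hC _ x)
    rw [← (Fin.snocEquiv fun _ : Fin (n + 2) => S).sum_comp, Fintype.sum_prod_type_right,
      Fin.prod_univ_castSucc]
    obtain ⟨x₀⟩ : Nonempty S := by
      by_contra h
      rw [not_nonempty_iff] at h
      simpa using hν.2
    refine le_trans (Finset.sum_le_sum fun x _ => ?_)
      ((Finset.sum_mul _ _ _).symm.trans_le (mul_le_mul_of_nonneg_right ih' (hC0 x₀)))
    simp only [Fin.snocEquiv, Equiv.coe_fn_mk, Fin.prod_univ_castSucc, ← mul_assoc,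
      ← Fin.castSucc_zero, Fin.snoc_castSucc, Fin.succ_castSucc, Fin.succ_last, Fin.snoc_last]
    rw [← Finset.mul_sum]
    exact mul_le_mul_of_nonneg_left (hC _ _)
      (mul_nonneg (hν.1 _) (Finset.prod_nonneg fun i _ => hK _ _ _))

end ExponentialMoments

/-! ### Path measurability and the Chernoff bound. -/

section Paths

variable {S : Type*} [Fintype S] [DecidableEq S] [MeasurableSpace S] [MeasurableSingletonClass S]
  {Ω : Type*} [MeasurableSpace Ω] {μ : Measure Ω} {L : Matrix S S ℝ} {ν : S → ℝ} {X : ℝ≥0 → Ω → S}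

/-- The expectation of a product along the chain is at most the product of the maximal one-step
expectations. -/
lemma IsMarkovChain.integral_prod_le [IsProbabilityMeasure μ] (hX : IsMarkovChain μ L ν X)
    (hL : IsGenerator L) (hν : ν ∈ stdSimplex ℝ S) {n : ℕ} {t : Fin (n + 1) → ℝ≥0}
    (ht : Monotone t) (ht0 : t 0 = 0) {φ : S → ℝ} (hφ : ∀ x, 0 ≤ φ x) (C : Fin n → ℝ)
    (hC : ∀ i x, ∑ y, transition L ((t i.succ : ℝ) - (t i.castSucc : ℝ)) x y * φ y ≤ C i) :
    ∫ ω, ∏ i : Fin n, φ (X (t i.succ) ω) ∂μ ≤ ∏ i, C i := by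
  have hY : Measurable fun ω => fun i => X (t i) ω := measurable_pi_lambda _ fun i => hX.measurable _
  have h1 : ∫ ω, ∏ i : Fin n, φ (X (t i.succ) ω) ∂μ
      = ∑ x : Fin (n + 1) → S, μ.real {ω | ∀ i, X (t i) ω = x i} * ∏ i : Fin n, φ (x i.succ) := by
    have := Measure.isProbabilityMeasure_map (μ := μ) hY.aemeasurable
    have h2 := integral_map (μ := μ) hY.aemeasurable
      (f := fun x : Fin (n + 1) → S => ∏ i : Fin n, φ (x i.succ))
      (measurable_of_countable _).aestronglyMeasurable
    rw [← h2, integral_fintype .of_finite]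
    refine Finset.sum_congr rfl fun x _ => ?_
    rw [map_measureReal_apply hY (measurableSet_singleton x), smul_eq_mul]
    congr 2
    ext ω
    exact funext_iff
  rw [h1]
  refine le_trans (le_of_eq ?_) (sum_mul_prod_kernel_le hν n
    (fun i x y => transition L ((t i.succ : ℝ) - (t i.castSucc : ℝ)) x y * φ y)
    (fun i x y => mul_nonneg (hL.transition_nonneg
      (sub_nonneg.2 (NNReal.coe_le_coe.2 (ht i.castSucc_le_succ))) x y) (hφ y)) C hC)
  refine Finset.sum_congr rfl fun x _ => ?_
  rw [hX.fdd n t ht ht0 x, Finset.prod_mul_distrib, mul_assoc]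

/-- A chain with right-continuous paths is jointly measurable up to null sets. -/
lemma IsMarkovChain.aestronglyMeasurable_comp [SFinite μ] (hX : IsMarkovChain μ L ν X) (f : S → ℝ)
    {c : ℝ → ℝ≥0} (hc : Measurable c) (ρ : Measure ℝ) [SFinite ρ] :
    AEStronglyMeasurable (fun z : Ω × ℝ => f (X (c z.2) z.1)) (μ.prod ρ) := by
  -- Sampling at the next grid point to the right uses countably many times, and right-continuity
  -- gives the limit.
  let Y : ℕ → Ω × ℝ → ℝ := fun N z =>
    f (X (((⌊(N + 1 : ℝ≥0) * c z.2⌋₊ : ℝ≥0) + 1) / (N + 1)) z.1)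
  have hY : ∀ N, Measurable (Y N) := fun N => by
    have h0 : ∀ u : ℝ≥0, Measurable fun ω => f (X u ω) := fun u =>
      (measurable_of_countable f).comp (hX.measurable u)
    have h1 : ∀ a : ℕ → ℝ≥0, Measurable fun z : Ω × ℕ => f (X (a z.2) z.1) := fun a =>
      measurable_from_prod_countable_left fun k => h0 (a k)
    have h2 : Measurable fun z : Ω × ℝ => (z.1, ⌊(N + 1 : ℝ≥0) * c z.2⌋₊) :=
      measurable_fst.prodMk (Nat.measurable_floor.comp
        (measurable_const.mul (hc.comp measurable_snd)))
    have h3 := (h1 fun k => ((k : ℝ≥0) + 1) / (N + 1)).comp h2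
    simp only [Function.comp_def] at h3
    exact h3
  refine (aemeasurable_of_tendsto_metrizable_ae' (f := Y) (fun N => (hY N).aemeasurable)
    ?_).aestronglyMeasurable
  have hgrid : ∀ s : ℝ≥0, Tendsto (fun N : ℕ => ((⌊(N + 1 : ℝ≥0) * s⌋₊ : ℝ≥0) + 1) / (N + 1)) atTop
      (𝓝[≥] s) := fun s => by
    have hpos : ∀ N : ℕ, (0 : ℝ≥0) < N + 1 := fun N => by positivity
    have hlow : ∀ N : ℕ, s ≤ ((⌊(N + 1 : ℝ≥0) * s⌋₊ : ℝ≥0) + 1) / (N + 1) := fun N => by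
      rw [le_div_iff₀ (hpos N), mul_comm]
      exact (Nat.lt_floor_add_one _).le
    have hup : ∀ N : ℕ, ((⌊(N + 1 : ℝ≥0) * s⌋₊ : ℝ≥0) + 1) / (N + 1) ≤
        s + 1 / (N + 1) := fun N => by
      rw [div_le_iff₀ (hpos N), add_mul s, one_div, inv_mul_cancel₀ (hpos N).ne', mul_comm s]
      gcongr
      exact Nat.floor_le zero_le
    refine tendsto_nhdsWithin_iff.2 ⟨?_, Eventually.of_forall hlow⟩
    refine tendsto_of_tendsto_of_tendsto_of_le_of_le tendsto_const_nhds ?_ hlow hup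
    simpa using tendsto_const_nhds.add (tendsto_one_div_add_atTop_nhds_zero_nat (𝕜 := ℝ≥0))
  filter_upwards [Measure.quasiMeasurePreserving_fst.ae hX.rightContinuous] with z hz
  refine tendsto_const_nhds.congr' ?_
  filter_upwards [(hgrid (c z.2)).eventually (hz (c z.2))] with N hN
  simp only [Y, hN]

/-- Jensen's inequality after folding an integral over `[0, n r]` onto `[0, r]`. -/
lemma exp_integral_le_integral_exp_sum {g : ℝ → ℝ} {n : ℕ} {r : ℝ} (hr : 0 < r)
    (hg : AEStronglyMeasurable g) (hg1 : ∀ s, |g s| ≤ 1) (l : ℝ) :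
    Real.exp (l * (r⁻¹ * ∫ s in (0 : ℝ)..n * r, g s)) ≤
      r⁻¹ * ∫ s in Set.Ioc 0 r, Real.exp (l * ∑ j ∈ Finset.range n, g (s + j * r)) := by
  have hint : ∀ a b, IntervalIntegrable g volume a b := fun a b =>
    (intervalIntegrable_const (c := (1 : ℝ))).mono_fun hg.restrict
      (Eventually.of_forall fun s => by simpa using hg1 s)
  have hshift : ∀ j : ℕ, IntervalIntegrable (fun s => g (s + j * r)) volume 0 r := fun j => by
    have := (hint (0 + j * r) (r + j * r)).comp_add_right (j * r)
    simpa using this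
  have hsum : ∫ s in (0 : ℝ)..n * r, g s
      = ∫ s in Set.Ioc 0 r, ∑ j ∈ Finset.range n, g (s + j * r) := by
    rw [← intervalIntegral.integral_of_le hr.le,
      intervalIntegral.integral_finsetSum fun j _ => hshift j]
    have := intervalIntegral.sum_integral_adjacent_intervals (f := g) (μ := volume)
      (a := fun j : ℕ => (j : ℝ) * r) (n := n) fun k _ => hint _ _
    simp only [Nat.cast_zero, zero_mul] at this
    rw [← this]
    refine Finset.sum_congr rfl fun j _ => ?_
    rw [intervalIntegral.integral_comp_add_right]
    push_cast
    congr 1 <;> ring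
  have hG : IntegrableOn (fun s => ∑ j ∈ Finset.range n, g (s + j * r)) (Set.Ioc 0 r) :=
    integrable_finsetSum _ fun j _ => (intervalIntegrable_iff_integrableOn_Ioc_of_le hr.le).1
      (hshift j)
  have hvol : volume.real (Set.Ioc 0 r) = r := by simp [hr.le]
  have hJ := ConvexOn.map_set_average_le (μ := volume) (t := Set.Ioc 0 r) convexOn_exp
    Real.continuous_exp.continuousOn isClosed_univ (by simp [hr]) (by simp)
    (f := fun s => l * ∑ j ∈ Finset.range n, g (s + j * r)) (by simp) (hG.const_mul l) (by
      refine Integrable.of_bound (C := Real.exp (|l| * n))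
        (Real.continuous_exp.comp_aestronglyMeasurable (hG.const_mul l).1)
        (Eventually.of_forall fun s => ?_)
      simp only [Function.comp_apply, Real.norm_eq_abs, Real.abs_exp]
      refine Real.exp_le_exp.2 ((le_abs_self _).trans ?_)
      rw [abs_mul]
      refine mul_le_mul_of_nonneg_left ((Finset.abs_sum_le_sum_abs _ _).trans ?_) (abs_nonneg _)
      exact (Finset.sum_le_sum fun j _ => hg1 _).trans_eq (by simp))
  rw [setAverage_eq, setAverage_eq, hvol, integral_const_mul, ← hsum, smul_eq_mul, smul_eq_mul] at hJ
  refine le_trans (le_of_eq ?_) hJ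
  congr 1
  ring

/-- Chernoff bound for additive functionals over `n` blocks of length `r`, in terms of a bound `C`
on the exponential moments of `f` one block length ahead. -/
lemma IsMarkovChain.measureReal_integral_ge_le [IsProbabilityMeasure μ] (hX : IsMarkovChain μ L ν X)
    (hL : IsGenerator L) (hν : ν ∈ stdSimplex ℝ S) {f : S → ℝ} (hf : ∀ x, |f x| ≤ 1)
    {r : ℝ} (hr : 0 < r) (m : ℕ) {l C γ : ℝ} (hl : 0 ≤ l)
    (hC : ∀ x, ∑ y, transition L r x y * Real.exp (l * f y) ≤ C) :
    μ.real {ω | γ * ((m + 1 : ℕ) * r) ≤ ∫ s in (0 : ℝ)..(m + 1 : ℕ) * r, f (X s.toNNReal ω)} ≤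
      Real.exp (-(l * γ * (m + 1))) * (Real.exp l * C ^ m) := by
  let G : Ω → ℝ → ℝ := fun ω s =>
    Real.exp (l * ∑ j ∈ Finset.range (m + 1), f (X (s + j * r).toNNReal ω))
  have hGmeas : AEStronglyMeasurable (Function.uncurry G)
      (μ.prod (volume.restrict (Set.Ioc 0 r))) := by
    refine Real.continuous_exp.comp_aestronglyMeasurable (AEStronglyMeasurable.const_mul ?_ l)
    refine Finset.aestronglyMeasurable_fun_sum _ fun j _ => ?_
    exact hX.aestronglyMeasurable_comp f (c := fun s => (s + j * r).toNNReal)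
      (by fun_prop) _
  have hGint : Integrable (Function.uncurry G) (μ.prod (volume.restrict (Set.Ioc 0 r))) := by
    refine Integrable.of_bound (C := Real.exp (l * (m + 1))) hGmeas
      (Eventually.of_forall fun z => ?_)
    simp only [Function.uncurry, G, Real.norm_eq_abs, Real.abs_exp]
    refine Real.exp_le_exp.2 (mul_le_mul_of_nonneg_left ?_ hl)
    exact (Finset.sum_le_sum fun j _ => (le_abs_self _).trans (hf _)).trans_eq (by simp)
  have hE : ∀ s ∈ Set.Ioc 0 r, ∫ ω, G ω s ∂μ ≤ Real.exp l * C ^ m := by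
    intro s hs
    -- Time `0` is prepended because `fdd` starts there. The initial step, of length `s`, may be too
    -- short to mix and is bounded by `exp l`; the other `m` steps have length `r` and contribute
    -- `C` each.
    let t : Fin (m + 2) → ℝ≥0 := Fin.cons 0 fun j : Fin (m + 1) => (s + j * r).toNNReal
    have hmono : Monotone t := by
      refine Fin.monotone_iff_le_succ.2 fun i => ?_
      refine Fin.cases ?_ (fun j => ?_) i
      · simp [t]
      · rw [← Fin.succ_castSucc]
        simp only [t, Fin.cons_succ]
        refine Real.toNNReal_le_toNNReal ?_
        simp only [Fin.val_castSucc, Fin.val_succ]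
        push_cast
        nlinarith
    have hprod := hX.integral_prod_le hL hν hmono (by simp [t])
      (φ := fun y => Real.exp (l * f y)) (fun y => (Real.exp_pos _).le)
      (Fin.cons (Real.exp l) fun _ : Fin m => C) (fun i x => by
        refine Fin.cases ?_ (fun j => ?_) i
        · refine (Finset.sum_le_sum fun y _ => mul_le_mul_of_nonneg_left
            (Real.exp_le_exp.2 (show l * f y ≤ l from ?_))
              (hL.transition_nonneg ?_ x y)).trans_eq ?_
          · nlinarith [(abs_le.1 (hf y)).2]
          · exact sub_nonneg.2 (NNReal.coe_le_coe.2 (hmono (Fin.castSucc_le_succ 0)))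
          · rw [← Finset.sum_mul, hL.transition_row_sum, one_mul, Fin.cons_zero]
        · have hd : ((t j.succ.succ : ℝ) - (t j.succ.castSucc : ℝ)) = r := by
            rw [← Fin.succ_castSucc]
            simp only [t, Fin.cons_succ, Fin.val_castSucc, Fin.val_succ]
            rw [Real.coe_toNNReal _ (by have := hs.1; positivity),
              Real.coe_toNNReal _ (by have := hs.1; positivity)]
            push_cast
            ring
          rw [hd, Fin.cons_succ]
          exact hC x)
    rw [Fin.prod_univ_succ] at hprod
    simp only [Fin.cons_zero, Fin.cons_succ, Finset.prod_const, Finset.card_univ,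
      Fintype.card_fin] at hprod
    refine le_trans (le_of_eq (integral_congr_ae (Eventually.of_forall fun ω => ?_))) hprod
    simp only [G, t, Fin.cons_succ, Finset.mul_sum, Real.exp_sum]
    exact Finset.prod_range fun j => Real.exp (l * f (X (s + j * r).toNNReal ω))
  have hpath : ∀ᵐ ω ∂μ, AEStronglyMeasurable (fun s : ℝ => f (X s.toNNReal ω)) volume :=
    (hX.aestronglyMeasurable_comp f measurable_real_toNNReal volume).prodMk_left
  have hmarkov := mul_meas_ge_le_integral_of_nonneg (μ := μ)
    (f := fun ω => r⁻¹ * ∫ s in Set.Ioc 0 r, G ω s)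
    (Eventually.of_forall fun ω => mul_nonneg (inv_nonneg.2 hr.le)
      (integral_nonneg fun s => (Real.exp_pos _).le))
    (hGint.integral_prod_left.const_mul _) (Real.exp (l * γ * (m + 1)))
  have hsub : μ.real {ω | γ * ((m + 1 : ℕ) * r) ≤
        ∫ s in (0 : ℝ)..(m + 1 : ℕ) * r, f (X s.toNNReal ω)} ≤
      μ.real {ω | Real.exp (l * γ * (m + 1)) ≤ r⁻¹ * ∫ s in Set.Ioc 0 r, G ω s} := by
    refine ENNReal.toReal_mono (measure_ne_top _ _) (measure_mono_ae ?_)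
    filter_upwards [hpath] with ω hω h
    refine le_trans (Real.exp_le_exp.2 ?_)
      (exp_integral_le_integral_exp_sum (n := m + 1) hr hω (fun s => hf _) l)
    rw [mul_assoc]
    refine mul_le_mul_of_nonneg_left ?_ hl
    rw [le_inv_mul_iff₀ hr]
    refine le_trans (le_of_eq ?_) h
    push_cast
    ring
  have hfub : ∫ ω, (r⁻¹ * ∫ s in Set.Ioc 0 r, G ω s) ∂μ ≤ Real.exp l * C ^ m := by
    rw [integral_const_mul, integral_integral_swap hGint, inv_mul_le_iff₀ hr]
    refine (setIntegral_mono_on hGint.integral_prod_right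
      (integrable_const (Real.exp l * C ^ m)) measurableSet_Ioc hE).trans_eq ?_
    simp [hr.le]
  rw [Real.exp_neg, le_inv_mul_iff₀ (Real.exp_pos _)]
  exact (mul_le_mul_of_nonneg_left hsub (Real.exp_pos _).le).trans (hmarkov.trans hfub)

end Paths

end CTMC

/-! ### The role of `k(γ)` and the final estimate. -/

namespace CTMC

variable {S : Type*} [Fintype S] [DecidableEq S] {L : Matrix S S ℝ} {π : S → ℝ}

/-- After `k(γ)` mixing times the transition probabilities exceed the invariant ones by at most a
factor `1 + γ² / (6σ²)`. -/
lemma transition_le_of_kFactor_mul_mixingTime_le (hπ : IsInvariant L π) (hirr : IsIrreducible L)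
    (hL : IsGenerator L) {σ γ s : ℝ} (hσ : σ ≠ 0) (hγ : γ ≠ 0) (hk : 1 ≤ kFactor π σ γ)
    (hs : kFactor π σ γ * mixingTime L π ≤ s) (x y : S) :
    transition L s x y ≤ π y * (1 + γ ^ 2 / (6 * σ ^ 2)) := by
  have := hπ.nonempty
  have hm := hπ.minMass_pos hirr hL
  have h1 := (sub_le_tvDist (by rw [hL.transition_row_sum, hπ.1.2]) y).trans
    (tvDist_transition_le_two_rpow hπ hirr hL hk hs x)
  -- `kFactor` is chosen so that `2 ^ (-k)` is this multiple of `minMass π`, which turns the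
  -- additive error into a relative one.
  rw [kFactor, neg_neg, Real.rpow_logb (by norm_num) (by norm_num) (by positivity)] at h1
  have h2 : minMass π * γ ^ 2 / (6 * σ ^ 2) ≤ π y * (γ ^ 2 / (6 * σ ^ 2)) := by
    rw [mul_div_assoc]
    exact mul_le_mul_of_nonneg_right (minMass_le π y) (by positivity)
  linarith

/-- Here `γ² ≤ σ²/2`, so the argument of the logarithm is at most `1/12`. -/
lemma one_le_kFactor (hπ : IsInvariant L π) (hirr : IsIrreducible L) (hL : IsGenerator L)
    {σ γ : ℝ} (hγ0 : 0 < γ) (hγσ : γ ≤ σ ^ 2) (hγ : γ ≤ 1 / 2) : 1 ≤ kFactor π σ γ := by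
  have := hπ.nonempty
  have hm := hπ.minMass_pos hirr hL
  have hσ : 0 < σ ^ 2 := hγ0.trans_le hγσ
  obtain ⟨x⟩ := hπ.nonempty
  have hm1 : minMass π ≤ 1 := (minMass_le π x).trans
    ((Finset.single_le_sum (fun y _ => hπ.1.1 y) (Finset.mem_univ x)).trans_eq hπ.1.2)
  have hle : minMass π * γ ^ 2 / (6 * σ ^ 2) ≤ 2 ^ (-1 : ℝ) := by
    rw [div_le_iff₀ (by positivity), Real.rpow_neg_one]
    nlinarith [mul_le_mul_of_nonneg_right hm1 (sq_nonneg γ)]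
  rw [kFactor, le_neg, Real.logb_le_iff_le_rpow (by norm_num) (by positivity)]
  exact hle

end CTMC

theorem corollaryA2 {S : Type*} [Fintype S] [DecidableEq S]
    [MeasurableSpace S] [MeasurableSingletonClass S]
    {Ω : Type*} [MeasurableSpace Ω] (μ : Measure Ω) [IsProbabilityMeasure μ]
    (L : Matrix S S ℝ) (hL : CTMC.IsGenerator L) (hirr : CTMC.IsIrreducible L)
    (ν : S → ℝ) (hν : ν ∈ stdSimplex ℝ S)
    (X : ℝ≥0 → Ω → S) (hX : CTMC.IsMarkovChain μ L ν X)
    (π : S → ℝ) (hπ : CTMC.IsInvariant L π)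
    (t : ℝ) (ht : 0 < t)
    (f : S → ℝ) (hf : ∀ x, f x ∈ Set.Icc (-1 : ℝ) 1) (hf0 : CTMC.mean π f = 0)
    (σ : ℝ) (hσ : CTMC.mean π (fun x => f x ^ 2) ≤ σ ^ 2)
    (γ : ℝ) (hγ0 : 0 < γ) (hγ : γ ≤ min (σ ^ 2) (1 / 2)) :
    μ.real {ω | γ * t ≤ ∫ s in (0 : ℝ)..t, f (X s.toNNReal ω)} ≤
      4 * Real.exp (-((⌊t / (CTMC.kFactor π σ γ * CTMC.mixingTime L π) - 1⌋ : ℤ) : ℝ) *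
        (γ ^ 2 / (6 * σ ^ 2))) := by
  have hγσ : γ ≤ σ ^ 2 := hγ.trans (min_le_left _ _)
  have hσ0 : 0 < σ ^ 2 := hγ0.trans_le hγσ
  have hk := CTMC.one_le_kFactor hπ hirr hL hγ0 hγσ (hγ.trans (min_le_right _ _))
  set τ := CTMC.kFactor π σ γ * CTMC.mixingTime L π with hτ
  have hτ0 : 0 ≤ τ := mul_nonneg (zero_le_one.trans hk) (CTMC.mixingTime_mem hπ hirr hL).1
  -- For a nonpositive floor the bound is at least `4`. This includes `τ = 0`, where `t / τ = 0`.
  rcases le_or_gt ⌊t / τ - 1⌋ 0 with hn | hn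
  · have h1 : (1 : ℝ) ≤ Real.exp (-((⌊t / τ - 1⌋ : ℤ) : ℝ) * (γ ^ 2 / (6 * σ ^ 2))) := by
      rw [Real.one_le_exp_iff]
      exact mul_nonneg (neg_nonneg.2 (by exact_mod_cast hn)) (by positivity)
    linarith [measureReal_le_one (μ := μ)
      (s := {ω | γ * t ≤ ∫ s in (0 : ℝ)..t, f (X s.toNNReal ω)})]
  · obtain ⟨m, hm⟩ := Int.eq_ofNat_of_zero_le hn.le
    have hmle : (m : ℝ) ≤ t / τ - 1 := by
      have := Int.floor_le (t / τ - 1)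
      rw [hm] at this
      exact_mod_cast this
    have hτpos : 0 < τ := by
      refine hτ0.lt_of_ne fun h => ?_
      rw [← h, div_zero] at hmle
      linarith [m.cast_nonneg (α := ℝ)]
    rw [hm, Int.cast_natCast]
    have hm1 : (0 : ℝ) < ((m + 1 : ℕ) : ℝ) := by positivity
    set r := t / (m + 1 : ℕ) with hr
    have hτr : τ ≤ r := by
      rw [hr, le_div_iff₀ hm1, mul_comm, ← le_div_iff₀ hτpos]
      push_cast
      linarith
    have htr : t = (m + 1 : ℕ) * r := by
      rw [hr]
      field_simp
    set q := γ ^ 2 / σ ^ 2 with hq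
    have hq0 : 0 ≤ q := by positivity
    have hq6 : γ ^ 2 / (6 * σ ^ 2) = q / 6 := by rw [hq]; ring
    -- `γ ≤ σ²` puts `l` in the range `l ≤ 1/2` required by `mean_exp_le`.
    set l := γ / (2 * σ ^ 2) with hl
    have hl0 : 0 ≤ l := by positivity
    have hl1 : l ≤ 1 / 2 := by
      rw [hl, div_le_iff₀ (by positivity)]
      linarith
    have hlγ : l * γ = q / 2 := by rw [hl, hq]; ring
    have hlσ : l ^ 2 * σ ^ 2 = q / 4 := by rw [hl, hq]; field_simp; norm_num
    have habs : ∀ x, |f x| ≤ 1 := fun x => abs_le.2 (hf x)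
    -- `23/72 = 1/6 + (11/18)/4`: mixing error plus variance term.
    have hC : ∀ x, ∑ y, CTMC.transition L r x y * Real.exp (l * f y) ≤ Real.exp (23 / 72 * q) := by
      intro x
      calc ∑ y, CTMC.transition L r x y * Real.exp (l * f y)
          ≤ ∑ y, π y * (1 + γ ^ 2 / (6 * σ ^ 2)) * Real.exp (l * f y) :=
            Finset.sum_le_sum fun y _ => mul_le_mul_of_nonneg_right
              (CTMC.transition_le_of_kFactor_mul_mixingTime_le hπ hirr hL
                (fun h => by simp [h] at hσ0) hγ0.ne' hk hτr x y) (Real.exp_pos _).le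
        _ = (q / 6 + 1) * CTMC.mean π (fun y => Real.exp (l * f y)) := by
            rw [CTMC.mean, Finset.mul_sum, hq6]
            exact Finset.sum_congr rfl fun y _ => by ring
        _ ≤ Real.exp (q / 6) * Real.exp (11 / 18 * l ^ 2 * CTMC.mean π (fun x => f x ^ 2)) :=
            mul_le_mul (Real.add_one_le_exp _) (CTMC.mean_exp_le hπ.1 habs hf0 hl0 hl1)
              (Finset.sum_nonneg fun y _ => mul_nonneg (hπ.1.1 y) (Real.exp_pos _).le)
              (Real.exp_pos _).le
        _ ≤ Real.exp (23 / 72 * q) := by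
            rw [← Real.exp_add, Real.exp_le_exp]
            have := mul_le_mul_of_nonneg_left hσ (sq_nonneg l)
            linarith
    have hmain := hX.measureReal_integral_ge_le hL hν habs (hτpos.trans_le hτr) m (γ := γ) hl0 hC
    rw [← htr] at hmain
    have h4 : Real.exp 1 ≤ 4 := by linarith [Real.exp_one_lt_d9]
    refine hmain.trans (le_trans ?_ (mul_le_mul_of_nonneg_right h4 (Real.exp_pos _).le))
    -- The exponent is `l - q/2 - (13/72) q m`, and `13/72 ≥ 1/6`, `l ≤ 1`.
    rw [← Real.exp_nat_mul, ← Real.exp_add, ← Real.exp_add, ← Real.exp_add, Real.exp_le_exp, hq6,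
      hlγ]
    nlinarith [mul_nonneg (m.cast_nonneg (α := ℝ)) hq0]
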